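/- Let $L_1,\dots,L_k\in \mathrm{Mat}_d(\mathbb{R})$ be simultaneously diagonalisable over $\mathbb{C}$ into the diagonal matrices $D_1,\dots,D_k$; that is, there is an invertible complex matrix $P$ with $P^{-1}L_lP=D_l=\mathrm{diag}(\lambda_{l1},\dots,\lambda_{ld})$ for every $l=1,\dots,k$, where each $\lambda_{li}\in\mathbb{C}$. Let $\mu$ be Lebesgue measure on $\mathbb{R}^d$, and for $A\subset\mathbb{R}^d$ write $L_1A+\dots+L_kA=\{L_1a_1+\dots+L_ka_k : a_1,\dots,a_k\in A\}$. Then, for every compact $A\subset\mathbb{R}^d$, $$\mu(L_1A+\dots+L_kA)\;\ge\;\Bigl(\prod_{i=1}^d\sum_{l=1}^k|\lambda_{li}|\Bigr)\,\mu(A).$$ Moreover, equality holds for some compact $A\subset\mathbb{R}^d$ with $\mu(A)>0$. -/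

import Mathlib

open MeasureTheory
open scoped Pointwise

/-- The real matrices `L l` are simultaneously diagonalised over `ℂ`, by one invertible complex
matrix `P`, into the diagonal matrices with diagonal entries `ev l 0, …, ev l (d - 1)`. -/
def SimultaneouslyDiagonalisableInto {k d : ℕ} (L : Fin k → Matrix (Fin d) (Fin d) ℝ)
    (ev : Fin k → Fin d → ℂ) : Prop :=
  ∃ P : Matrix (Fin d) (Fin d) ℂ, IsUnit P ∧
    ∀ l, P⁻¹ * (L l).map Complex.ofReal * P = Matrix.diagonal (ev l)

/-- The Minkowski sum `L₁ A + ⋯ + L_k A` of the images of `A` under the matrices `L l`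
(the empty sum, for `k = 0`, is `{0}`). -/
def sumOfImages {k d : ℕ} (L : Fin k → Matrix (Fin d) (Fin d) ℝ) (A : Set (Fin d → ℝ)) :
    Set (Fin d → ℝ) :=
  ∑ l, (L l).mulVec '' A

/-! Over `ℂ` the matrices become diagonal, at the cost of doubling the real dimension. Write `S` for
the sum of images. Real matrices act separately on real and imaginary parts, so summing the images
of `A + iA` stays inside `S + iS`. These sets have volumes `μ(A)²` and `μ(S)²`, and the change of
basis `P⁻¹` scales both sides alike. It remains to prove `IsCompact.volume_sum_image_mul_ge`, the
diagonal inequality in `ℂ^d` with the constant squared.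

There, Schwarz symmetrisation in one complex coordinate preserves volume and does not enlarge the
sum (`volume_sum_image_schwarz_le`), because planar Brunn–Minkowski makes `√area` superadditive and
multiplication by `c` scales it by `‖c‖`. After all coordinates are treated, the set is invariant
under phases, so each coefficient may be replaced by its modulus, and the sum contains a diagonal
dilate of the set (`PhaseInvariant.volume_le`).

Equality holds for the polydisc in eigencoordinates: its sum lies in its image under the matrix with
eigenvalues `∑ l, ‖ev l i‖`, which is real because conjugate joint eigenvalues have equal moduli. -/

/-! ### Brunn–Minkowski in dimensions one and two -/

/-- One-dimensional Brunn–Minkowski inequality for compact sets. -/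
theorem IsCompact.volume_add_volume_le {U V : Set ℝ} (hU : IsCompact U) (hV : IsCompact V)
    (hU' : U.Nonempty) (hV' : V.Nonempty) : volume U + volume V ≤ volume (U + V) := by
  obtain ⟨M, hM, hMax⟩ := hU.exists_isGreatest hU'
  obtain ⟨m, hm, hMin⟩ := hV.exists_isLeast hV'
  -- The translates `U + m` and `M + V` lie in `U + V`, on opposite sides of their only common point
  -- `M + m`.
  have h1 : volume ((fun x => x + m) '' U) = volume U := by simp
  have h2 : volume ((fun x => M + x) '' V) = volume V := by simp
  have hinter : volume ((fun x => x + m) '' U ∩ (fun x => M + x) '' V) = 0 := by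
    refine measure_mono_null (t := {M + m}) ?_ (by simp)
    rintro _ ⟨⟨x, hx, rfl⟩, ⟨y, hy, hxy⟩⟩
    have := hMax hx
    have := hMin hy
    simp only [Set.mem_singleton_iff] at *
    linarith
  have hmeas : MeasurableSet ((fun x => M + x) '' V) :=
    (hV.image (by fun_prop)).measurableSet
  rw [← h1, ← h2, ← measure_union_add_inter _ hmeas, hinter, add_zero]
  refine measure_mono (Set.union_subset ?_ ?_)
  · rintro _ ⟨x, hx, rfl⟩
    exact Set.add_mem_add hx hm
  · rintro _ ⟨x, hx, rfl⟩
    exact Set.add_mem_add hM hx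

/-- One-dimensional Brunn–Minkowski inequality for measurable sets. -/
theorem MeasurableSet.volume_add_volume_le {U V : Set ℝ} (hU : MeasurableSet U)
    (hV : MeasurableSet V) (hU' : U.Nonempty) (hV' : V.Nonempty) :
    volume U + volume V ≤ volume (U + V) := by
  obtain ⟨u, hu⟩ := hU'
  obtain ⟨v, hv⟩ := hV'
  rw [hU.measure_eq_iSup_isCompact, hV.measure_eq_iSup_isCompact]
  simp_rw [iSup_and']
  refine ENNReal.biSup_add_biSup_le' ⟨∅, by simp⟩ ⟨∅, by simp⟩ fun K hK K' hK' => ?_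
  -- An approximating compact set may be empty; adjoining `u` and `v` makes the compact case
  -- applicable.
  calc volume K + volume K' ≤ volume (insert u K) + volume (insert v K') := by gcongr <;> simp
    _ ≤ volume (insert u K + insert v K') :=
      (hK.2.insert u).volume_add_volume_le (hK'.2.insert v) (Set.insert_nonempty _ _)
        (Set.insert_nonempty _ _)
    _ ≤ _ := measure_mono (Set.add_subset_add (Set.insert_subset hu hK.1)
        (Set.insert_subset hv hK'.1))

/-- Level-set form of the one-dimensional Brunn–Minkowski inequality: three functions whose
superlevel sets at heights in `(0, 1)` satisfy `{φ > t} + {ψ > t} ⊆ {η > t}`, where `φ` and `ψ`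
have supremum `1`. -/
theorem lintegral_add_lintegral_le_of_superlevel {φ ψ η : ℝ → ℝ} (hφ : Measurable φ)
    (hψ : Measurable ψ) (hη : Measurable η) (hφ0 : 0 ≤ φ) (hψ0 : 0 ≤ ψ) (hη0 : 0 ≤ η)
    (hφ1 : IsLUB (Set.range φ) 1) (hψ1 : IsLUB (Set.range ψ) 1)
    (h : ∀ t ∈ Set.Ioo (0 : ℝ) 1, ∀ x y, t < φ x → t < ψ y → t < η (x + y)) :
    (∫⁻ x, ENNReal.ofReal (φ x)) + ∫⁻ x, ENNReal.ofReal (ψ x) ≤ ∫⁻ x, ENNReal.ofReal (η x) := by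
  have layer : ∀ f : ℝ → ℝ, Measurable f → 0 ≤ f →
      ∫⁻ x, ENNReal.ofReal (f x) = ∫⁻ t in Set.Ioi (0 : ℝ), volume {x | t < f x} := fun f hf h0 =>
    lintegral_eq_lintegral_meas_lt _ (Filter.Eventually.of_forall h0) hf.aemeasurable
  rw [layer φ hφ hφ0, layer ψ hψ hψ0, layer η hη hη0, ← lintegral_add_left]
  swap
  · exact Antitone.measurable fun s t hst => measure_mono fun x (hx : t < φ x) => hst.trans_lt hx
  refine setLIntegral_mono' measurableSet_Ioi fun t ht => ?_
  -- Both suprema being `1`, the two superlevel sets are nonempty for exactly the same positive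
  -- heights, which is what Brunn–Minkowski on the line requires.
  rcases lt_or_ge t 1 with ht1 | ht1
  · obtain ⟨_, ⟨x, rfl⟩, hx, -⟩ := hφ1.exists_between ht1
    obtain ⟨_, ⟨y, rfl⟩, hy, -⟩ := hψ1.exists_between ht1
    refine ((measurableSet_lt measurable_const hφ).volume_add_volume_le
      (measurableSet_lt measurable_const hψ) ⟨x, hx⟩ ⟨y, hy⟩).trans (measure_mono ?_)
    rintro _ ⟨x, hx, y, hy, rfl⟩
    exact h t ⟨ht, ht1⟩ x y hx hy
  · have h1 : {x | t < φ x} = ∅ :=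
      Set.eq_empty_of_forall_notMem fun x hx => (hx.trans_le (hφ1.1 ⟨x, rfl⟩)).not_ge ht1
    have h2 : {x | t < ψ x} = ∅ :=
      Set.eq_empty_of_forall_notMem fun x hx => (hx.trans_le (hψ1.1 ⟨x, rfl⟩)).not_ge ht1
    simp [h1, h2]

theorem IsCompact.preimage_prodMk {α β : Type*} [TopologicalSpace α] [TopologicalSpace β]
    [T2Space α] [T2Space β] {X : Set (α × β)} (hX : IsCompact X) (a : α) :
    IsCompact (Prod.mk a ⁻¹' X) :=
  (hX.image continuous_snd).of_isClosed_subset (hX.isClosed.preimage (by fun_prop))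
    fun b hb => ⟨(a, b), hb, rfl⟩

/-- The section lengths of a planar compact set of positive area have a positive supremum `a`, so
that after division by `a` their supremum is `1`. -/
theorem IsCompact.exists_isLUB_section {X : Set (ℝ × ℝ)} (hX : IsCompact X)
    (hpos : 0 < volume.real X) :
    ∃ a : ℝ, 0 < a ∧
      IsLUB (Set.range fun x => volume.real (Prod.mk x ⁻¹' X) / a) 1 := by
  have hbdd : BddAbove (Set.range fun x => volume.real (Prod.mk x ⁻¹' X)) := by
    refine ⟨volume.real (Prod.snd '' X), ?_⟩
    rintro _ ⟨x, rfl⟩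
    exact measureReal_mono (fun b hb => ⟨(x, b), hb, rfl⟩)
      (hX.image continuous_snd).measure_lt_top.ne
  set a := sSup (Set.range fun x => volume.real (Prod.mk x ⁻¹' X))
  have hlub := isLUB_csSup (Set.range_nonempty _) hbdd
  have ha0 : 0 < a := by
    by_contra hle
    refine hpos.ne' ?_
    rw [measureReal_eq_zero_iff hX.measure_lt_top.ne, Measure.volume_eq_prod,
      Measure.measure_prod_null hX.measurableSet]
    refine Filter.Eventually.of_forall fun x => ?_
    have h0 : volume.real (Prod.mk x ⁻¹' X) = 0 :=
      le_antisymm ((hlub.1 ⟨x, rfl⟩).trans (not_lt.1 hle)) measureReal_nonneg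
    exact (measureReal_eq_zero_iff (hX.preimage_prodMk x).measure_lt_top.ne).1 h0
  refine ⟨a, ha0, ?_, ?_⟩
  · rintro _ ⟨x, rfl⟩
    exact (div_le_one ha0).2 (hlub.1 ⟨x, rfl⟩)
  · intro b hb
    have : a ≤ b * a := hlub.2 (by
      rintro _ ⟨x, rfl⟩
      exact (div_le_iff₀ ha0).1 (hb ⟨x, rfl⟩))
    nlinarith

theorem IsCompact.lintegral_section_div {X : Set (ℝ × ℝ)} (hX : IsCompact X) (a : ℝ) :
    ∫⁻ x, ENNReal.ofReal (volume.real (Prod.mk x ⁻¹' X) / a) =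
      ENNReal.ofReal (volume.real X / a) := by
  simp_rw [div_eq_mul_inv, ENNReal.ofReal_mul measureReal_nonneg,
    fun x => ofReal_measureReal (μ := volume) (hX.preimage_prodMk x).measure_lt_top.ne]
  rw [lintegral_mul_const _ (measurable_measure_prodMk_left hX.measurableSet),
    ofReal_measureReal hX.measure_lt_top.ne, Measure.volume_eq_prod,
    Measure.prod_apply hX.measurableSet]

theorem IsCompact.measurable_section {X : Set (ℝ × ℝ)} (hX : IsCompact X) :
    Measurable fun x => volume.real (Prod.mk x ⁻¹' X) :=
  (measurable_measure_prodMk_left hX.measurableSet).ennreal_toReal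

/-- Planar Brunn–Minkowski inequality for compact sets. -/
theorem IsCompact.sqrt_volume_add_le_real_prod {X Y : Set (ℝ × ℝ)} (hX : IsCompact X)
    (hY : IsCompact Y) (hX' : X.Nonempty) (hY' : Y.Nonempty) :
    √(volume.real X) + √(volume.real Y) ≤ √(volume.real (X + Y)) := by
  have hXY : IsCompact (X + Y) := hX.add hY
  rcases (measureReal_nonneg (μ := volume) (s := X)).eq_or_lt with hX0 | hX0
  · obtain ⟨x, hx⟩ := hX'
    rw [← hX0, Real.sqrt_zero, zero_add]
    refine Real.sqrt_le_sqrt ?_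
    calc volume.real Y = volume.real (x +ᵥ Y) := by simp [Measure.real]
      _ ≤ _ := measureReal_mono (Set.vadd_set_subset_add hx) hXY.measure_lt_top.ne
  rcases (measureReal_nonneg (μ := volume) (s := Y)).eq_or_lt with hY0 | hY0
  · obtain ⟨y, hy⟩ := hY'
    rw [← hY0, Real.sqrt_zero, add_zero]
    refine Real.sqrt_le_sqrt ?_
    calc volume.real X = volume.real (y +ᵥ X) := by simp [Measure.real]
      _ ≤ _ := measureReal_mono (add_comm X Y ▸ Set.vadd_set_subset_add hy)
        hXY.measure_lt_top.ne
  obtain ⟨a, ha, hfa⟩ := hX.exists_isLUB_section hX0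
  obtain ⟨b, hb, hgb⟩ := hY.exists_isLUB_section hY0
  have hab : 0 < a + b := add_pos ha hb
  -- Normalised section lengths give `|X|/a + |Y|/b ≤ |X + Y|/(a + b)`. By Cauchy–Schwarz, `(p + q)²
  -- ≤ (p²/a + q²/b)(a + b)`.
  have key := lintegral_add_lintegral_le_of_superlevel
    (hX.measurable_section.div_const a) (hY.measurable_section.div_const b)
    (hXY.measurable_section.div_const (a + b))
    (fun x => div_nonneg measureReal_nonneg ha.le) (fun x => div_nonneg measureReal_nonneg hb.le)
    (fun x => div_nonneg measureReal_nonneg hab.le) hfa hgb ?_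
  · rw [hX.lintegral_section_div a, hY.lintegral_section_div b, hXY.lintegral_section_div (a + b),
      ← ENNReal.ofReal_add (by positivity) (by positivity),
      ENNReal.ofReal_le_ofReal_iff (by positivity), le_div_iff₀ hab] at key
    refine Real.le_sqrt_of_sq_le (le_trans ?_ key)
    obtain ⟨p, hp, hpX⟩ : ∃ p, 0 ≤ p ∧ volume.real X = p ^ 2 :=
      ⟨_, Real.sqrt_nonneg _, (Real.sq_sqrt measureReal_nonneg).symm⟩
    obtain ⟨q, hq, hqY⟩ : ∃ q, 0 ≤ q ∧ volume.real Y = q ^ 2 :=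
      ⟨_, Real.sqrt_nonneg _, (Real.sq_sqrt measureReal_nonneg).symm⟩
    rw [hpX, hqY, Real.sqrt_sq hp, Real.sqrt_sq hq, div_add_div _ _ ha.ne' hb.ne',
      div_mul_eq_mul_div, le_div_iff₀ (by positivity)]
    nlinarith [sq_nonneg (p * b - q * a)]
  · intro t ht x y hx hy
    rw [lt_div_iff₀ ‹_›] at hx hy ⊢
    have hne : ∀ {Z : Set (ℝ × ℝ)} {c s : ℝ}, 0 < c → t * c < volume.real (Prod.mk s ⁻¹' Z) →
        (Prod.mk s ⁻¹' Z).Nonempty := fun hc h => by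
      by_contra he
      rw [Set.not_nonempty_iff_eq_empty.1 he, measureReal_empty] at h
      exact (mul_pos ht.1 hc).not_gt h
    have hadd : volume.real (Prod.mk x ⁻¹' X) + volume.real (Prod.mk y ⁻¹' Y) ≤
        volume.real (Prod.mk x ⁻¹' X + Prod.mk y ⁻¹' Y) := by
      have hc := (hX.preimage_prodMk x).add (hY.preimage_prodMk y)
      rw [Measure.real, Measure.real, ← ENNReal.toReal_add
        (hX.preimage_prodMk x).measure_lt_top.ne (hY.preimage_prodMk y).measure_lt_top.ne]
      exact ENNReal.toReal_mono hc.measure_lt_top.ne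
        ((hX.preimage_prodMk x).volume_add_volume_le (hY.preimage_prodMk y) (hne ha hx) (hne hb hy))
    have hsub : Prod.mk x ⁻¹' X + Prod.mk y ⁻¹' Y ⊆ Prod.mk (x + y) ⁻¹' (X + Y) := by
      rintro _ ⟨u, hu, v, hv, rfl⟩
      exact ⟨(x, u), hu, (y, v), hv, rfl⟩
    have := measureReal_mono (μ := volume) hsub (hXY.preimage_prodMk _).measure_lt_top.ne
    linarith

/-- The real determinant is the norm from `ℂ` to `ℝ` of the complex one, hence its squared modulus.
-/
theorem addHaar_image_complex_linearMap {E : Type*} [NormedAddCommGroup E] [NormedSpace ℝ E]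
    [NormedSpace ℂ E] [IsScalarTower ℝ ℂ E] [MeasurableSpace E] [BorelSpace E]
    [FiniteDimensional ℝ E] (μ : Measure E) [μ.IsAddHaarMeasure] (f : E →ₗ[ℂ] E) (s : Set E) :
    μ (f '' s) = ENNReal.ofReal (‖LinearMap.det f‖ ^ 2) * μ s := by
  have : FiniteDimensional ℂ E := FiniteDimensional.right ℝ ℂ E
  have h := Measure.addHaar_image_linearMap μ (f.restrictScalars ℝ) s
  rw [LinearMap.det_restrictScalars, Algebra.norm_complex_eq,
    LinearMap.coe_restrictScalars] at h
  simpa [Complex.normSq_eq_norm_sq] using h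

theorem IsCompact.sqrt_volume_add_le_complex {X Y : Set ℂ} (hX : IsCompact X)
    (hY : IsCompact Y) (hX' : X.Nonempty) (hY' : Y.Nonempty) :
    √(volume.real X) + √(volume.real Y) ≤ √(volume.real (X + Y)) := by
  have hvol : ∀ Z : Set ℂ, volume.real (Complex.equivRealProdCLM '' Z) = volume.real Z := by
    intro Z
    rw [Measure.real, ← Complex.volume_preserving_equiv_real_prod.measure_preimage_equiv]
    congr 2
    exact Set.preimage_image_eq Z Complex.equivRealProdCLM.injective
  have h := (hX.image Complex.equivRealProdCLM.continuous).sqrt_volume_add_le_real_prod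
    (hY.image Complex.equivRealProdCLM.continuous) (hX'.image _) (hY'.image _)
  rwa [← Set.image_add, hvol, hvol, hvol] at h

theorem IsCompact.finsetSum {κ E : Type*} [AddCommMonoid E] [TopologicalSpace E]
    [ContinuousAdd E] (s : Finset κ) {X : κ → Set E} (hX : ∀ l ∈ s, IsCompact (X l)) :
    IsCompact (∑ l ∈ s, X l) := by
  classical
  induction s using Finset.induction_on with
  | empty => simp
  | insert a s ha ih =>
    rw [Finset.sum_insert ha]
    exact (hX a (by simp)).add (ih fun l hl => hX l (by simp [hl]))

theorem isCompact_sum_image_mul {ι κ : Type*} [Fintype κ] (c : κ → ι → ℂ) {B : Set (ι → ℂ)}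
    (hB : IsCompact B) : IsCompact (∑ l, (fun x => c l * x) '' B) :=
  .finsetSum _ fun l _ => hB.image (by fun_prop)

theorem sum_sqrt_volume_le {κ : Type*} (s : Finset κ) {X : κ → Set ℂ}
    (hX : ∀ l, IsCompact (X l)) (hX' : ∀ l, (X l).Nonempty) :
    ∑ l ∈ s, √(volume.real (X l)) ≤ √(volume.real (∑ l ∈ s, X l)) := by
  classical
  induction s using Finset.induction_on with
  | empty => simp
  | insert a s ha ih =>
    rw [Finset.sum_insert ha, Finset.sum_insert ha]
    have hne : (∑ l ∈ s, X l).Nonempty := by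
      choose g hg using hX'
      exact ⟨_, Set.finsetSum_mem_finsetSum s X g fun l _ => hg l⟩
    exact (add_le_add_right ih _).trans
      ((hX a).sqrt_volume_add_le_complex (.finsetSum s fun l _ => hX l) (hX' a) hne)

theorem sqrt_volume_image_mul_left (c : ℂ) (X : Set ℂ) :
    √(volume.real ((fun z => c * z) '' X)) = ‖c‖ * √(volume.real X) := by
  have h := addHaar_image_complex_linearMap volume (LinearMap.mul ℂ ℂ c) X
  have hdet : LinearMap.det (LinearMap.mul ℂ ℂ c) = c := by
    simp [LinearMap.det_ring]
  rw [hdet] at h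
  have h' : volume.real ((fun z => c * z) '' X) = ‖c‖ ^ 2 * volume.real X := by
    have := congrArg ENNReal.toReal h
    rwa [ENNReal.toReal_mul, ENNReal.toReal_ofReal (by positivity)] at this
  rw [h', Real.sqrt_mul (by positivity), Real.sqrt_sq (norm_nonneg c)]

/-- Brunn–Minkowski inequality in the complex plane, with complex coefficients. -/
theorem sum_norm_mul_sqrt_volume_le {κ : Type*} [Fintype κ] (c : κ → ℂ) {X : κ → Set ℂ}
    (hX : ∀ l, IsCompact (X l)) (hX' : ∀ l, (X l).Nonempty) :
    ∑ l, ‖c l‖ * √(volume.real (X l)) ≤ √(volume.real (∑ l, (fun z => c l * z) '' X l)) := by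
  simp_rw [← sqrt_volume_image_mul_left]
  exact sum_sqrt_volume_le _ (fun l => (hX l).image (by fun_prop)) fun l => (hX' l).image _

/-! ### Schwarz symmetrisation in one complex coordinate -/

/-- The radius of the disc with the same area as `S`. -/
noncomputable def discRadius (S : Set ℂ) : ℝ := √(volume.real S / Real.pi)

theorem discRadius_nonneg (S : Set ℂ) : 0 ≤ discRadius S := Real.sqrt_nonneg _

theorem volume_closedBall_le_iff {S : Set ℂ} (hS : volume S ≠ ⊤) {r : ℝ} (hr : 0 ≤ r) :
    volume (Metric.closedBall (0 : ℂ) r) ≤ volume S ↔ r ≤ discRadius S := by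
  have hball : volume (Metric.closedBall (0 : ℂ) r) = ENNReal.ofReal (r ^ 2 * Real.pi) := by
    rw [Complex.volume_closedBall, ENNReal.ofReal_mul (by positivity), ENNReal.ofReal_pow hr,
      ← NNReal.coe_real_pi, ENNReal.ofReal_coe_nnreal]
  rw [hball, ENNReal.ofReal_le_iff_le_toReal hS, discRadius, Real.le_sqrt hr,
    le_div_iff₀ Real.pi_pos, Measure.real]
  positivity

theorem volume_closedBall_discRadius {S : Set ℂ} (hS : volume S ≠ ⊤) :
    volume (Metric.closedBall (0 : ℂ) (discRadius S)) = volume S := by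
  rw [Complex.volume_closedBall, ← ENNReal.ofReal_pow (discRadius_nonneg S), discRadius,
    Real.sq_sqrt (by positivity), ENNReal.ofReal_div_of_pos Real.pi_pos,
    ofReal_measureReal hS, ← NNReal.coe_real_pi, ENNReal.ofReal_coe_nnreal,
    ENNReal.div_mul_cancel (by simp [NNReal.pi_ne_zero]) (by simp)]

theorem discRadius_mono {S T : Set ℂ} (h : S ⊆ T) (hT : volume T ≠ ⊤) :
    discRadius S ≤ discRadius T := by
  unfold discRadius
  gcongr

section Symmetrisation

variable {ι : Type*} [DecidableEq ι]

/-- The section of `B` through `x` in the direction of the `i`-th coordinate. -/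
def coordSection (B : Set (ι → ℂ)) (i : ι) (x : ι → ℂ) : Set ℂ :=
  {z | Function.update x i z ∈ B}

theorem coordSection_update (B : Set (ι → ℂ)) (i : ι) (x : ι → ℂ) (w : ℂ) :
    coordSection B i (Function.update x i w) = coordSection B i x := by
  simp [coordSection]

theorem coordSection_subset_eval (B : Set (ι → ℂ)) (i : ι) (x : ι → ℂ) :
    coordSection B i x ⊆ Function.eval i '' B := fun z hz => ⟨_, hz, by simp⟩

theorem isCompact_coordSection {B : Set (ι → ℂ)} (hB : IsCompact B) (i : ι) (x : ι → ℂ) :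
    IsCompact (coordSection B i x) :=
  (hB.image (continuous_apply i)).of_isClosed_subset
    (hB.isClosed.preimage (by fun_prop)) (coordSection_subset_eval B i x)

/-- Schwarz symmetrisation: every nonempty section in the `i`-th coordinate is replaced by the
centred disc of the same area. -/
def schwarz (B : Set (ι → ℂ)) (i : ι) : Set (ι → ℂ) :=
  {x | (coordSection B i x).Nonempty ∧
    volume (Metric.closedBall (0 : ℂ) ‖x i‖) ≤ volume (coordSection B i x)}

theorem mem_schwarz_iff {B : Set (ι → ℂ)} (hB : IsCompact B) {i : ι} {x : ι → ℂ} :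
    x ∈ schwarz B i ↔
      (coordSection B i x).Nonempty ∧ ‖x i‖ ≤ discRadius (coordSection B i x) := by
  rw [schwarz, Set.mem_ofPred_eq,
    volume_closedBall_le_iff (isCompact_coordSection hB i x).measure_lt_top.ne (norm_nonneg _)]

theorem volume_coordSection_schwarz {B : Set (ι → ℂ)} (hB : IsCompact B) (i : ι) (x : ι → ℂ) :
    volume (coordSection (schwarz B i) i x) = volume (coordSection B i x) := by
  rcases (coordSection B i x).eq_empty_or_nonempty with he | hne
  · rw [he]
    congr 1
    refine Set.eq_empty_of_forall_notMem fun z hz => ?_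
    have := hz.1
    rw [coordSection_update, he] at this
    exact Set.not_nonempty_empty this
  · rw [← volume_closedBall_discRadius (isCompact_coordSection hB i x).measure_lt_top.ne]
    congr 1
    ext z
    change Function.update x i z ∈ schwarz B i ↔ _
    rw [mem_schwarz_iff hB, coordSection_update]
    simp [hne]

/-- Sections of a compact set depend upper semicontinuously on the base point. -/
theorem eventually_coordSection_subset {B : Set (ι → ℂ)} (hB : IsCompact B) {i : ι}
    {x : ι → ℂ} {U : Set ℂ} (hU : IsOpen U) (h : coordSection B i x ⊆ U) :
    ∀ᶠ y in nhds x, coordSection B i y ⊆ U := by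
  have hopen : IsOpen {p : (ι → ℂ) × ℂ | Function.update p.1 i p.2 ∈ B → p.2 ∈ U} := by
    simp_rw [imp_iff_not_or]
    exact (hB.isClosed.isOpen_compl.preimage (by fun_prop)).union (hU.preimage continuous_snd)
  have := (hB.image (continuous_apply i)).eventually_forall_of_forall_eventually
    (x₀ := x) (P := fun y z => Function.update y i z ∈ B → z ∈ U)
    fun z _ => hopen.mem_nhds (show Function.update x i z ∈ B → z ∈ U from fun hz => h hz)
  filter_upwards [this] with y hy z hz
  exact hy z (coordSection_subset_eval B i y hz) hz

theorem isClosed_schwarz {B : Set (ι → ℂ)} (hB : IsCompact B) (i : ι) :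
    IsClosed (schwarz B i) := by
  rw [← isOpen_compl_iff, isOpen_iff_eventually]
  intro x hx
  rcases (coordSection B i x).eq_empty_or_nonempty with he | hne
  · filter_upwards [eventually_coordSection_subset hB isOpen_empty he.subset] with y hy hy'
    exact Set.not_nonempty_empty (hy'.1.mono hy)
  · have hlt : volume (coordSection B i x) < volume (Metric.closedBall (0 : ℂ) ‖x i‖) := by
      by_contra hle
      exact hx ⟨hne, not_lt.1 hle⟩
    -- Outer regularity gives an open `U` of area below `r` around the section. Nearby sections stay
    -- in `U`, while the disc area, being continuous, stays above `r`.
    obtain ⟨r, hr1, hr2⟩ := exists_between hlt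
    obtain ⟨U, hSU, hU, hUr⟩ := (coordSection B i x).exists_isOpen_lt_of_lt r hr1
    have hcont : Continuous fun y : ι → ℂ => volume (Metric.closedBall (0 : ℂ) ‖y i‖) := by
      simp_rw [Complex.volume_closedBall]
      refine ENNReal.continuous_mul_const (by simp) |>.comp ?_
      exact (ENNReal.continuous_pow 2).comp (ENNReal.continuous_ofReal.comp (by fun_prop))
    filter_upwards [eventually_coordSection_subset hB hU hSU,
      hcont.continuousAt.eventually_const_lt hr2] with y hy1 hy2 hy'
    exact (hy'.2.trans ((measure_mono hy1).trans hUr.le)).not_gt hy2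

theorem isCompact_schwarz {B : Set (ι → ℂ)} (hB : IsCompact B) (i : ι) :
    IsCompact (schwarz B i) := by
  have hK : IsCompact (Set.univ.pi fun j => Function.update (fun j => Function.eval j '' B) i
      (Metric.closedBall (0 : ℂ) (discRadius (Function.eval i '' B))) j) := by
    refine isCompact_univ_pi fun j => ?_
    by_cases hj : j = i
    · subst hj
      simpa using isCompact_closedBall _ _
    · simpa [hj] using hB.image (continuous_apply j)
  refine hK.of_isClosed_subset (isClosed_schwarz hB i) fun x hx j _ => ?_
  obtain ⟨⟨z, hz⟩, hx⟩ := (mem_schwarz_iff hB).1 hx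
  by_cases hj : j = i
  · subst hj
    simpa using hx.trans (discRadius_mono (coordSection_subset_eval B j x)
      (hB.image (continuous_apply j)).measure_lt_top.ne)
  · simpa [hj] using ⟨_, hz, by simp [hj]⟩

section Volume

variable [Fintype ι]

/-- Fubini: the marginal over the `i`-th coordinate is the area of the section. -/
theorem volume_le_of_coordSection_le {B C : Set (ι → ℂ)} (hB : MeasurableSet B)
    (hC : MeasurableSet C) (i : ι)
    (h : ∀ x, volume (coordSection B i x) ≤ volume (coordSection C i x)) :
    volume B ≤ volume C := by
  have key : ∀ D : Set (ι → ℂ), MeasurableSet D → ∀ x,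
      ∫⁻ z, D.indicator (1 : (ι → ℂ) → ENNReal) (Function.update x i z) =
        volume (coordSection D i x) := by
    intro D hD x
    rw [← lintegral_indicator_one (show MeasurableSet (coordSection D i x) from
      hD.preimage (measurable_update x))]
    rfl
  rw [← lintegral_indicator_one hB, ← lintegral_indicator_one hC, volume_pi]
  refine lintegral_le_of_lmarginal_le {i} (measurable_one.indicator hB)
    (measurable_one.indicator hC) ?_
  rw [lmarginal_singleton, lmarginal_singleton]
  intro x
  simpa only [key B hB, key C hC] using h x

theorem volume_schwarz {B : Set (ι → ℂ)} (hB : IsCompact B) (i : ι) :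
    volume (schwarz B i) = volume B :=
  le_antisymm
    (volume_le_of_coordSection_le (isCompact_schwarz hB i).measurableSet hB.measurableSet i
      fun x => (volume_coordSection_schwarz hB i x).le)
    (volume_le_of_coordSection_le hB.measurableSet (isCompact_schwarz hB i).measurableSet i
      fun x => (volume_coordSection_schwarz hB i x).ge)

variable {κ : Type*} [Fintype κ]

/-- Schwarz symmetrisation does not increase the volume of a sum of diagonal images. -/
theorem volume_sum_image_schwarz_le (c : κ → ι → ℂ) {B : Set (ι → ℂ)} (hB : IsCompact B)
    (i : ι) :
    volume (∑ l, (fun x => c l * x) '' schwarz B i) ≤ volume (∑ l, (fun x => c l * x) '' B) := by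
  have hT := isCompact_sum_image_mul c hB
  refine volume_le_of_coordSection_le
    (isCompact_sum_image_mul c (isCompact_schwarz hB i)).measurableSet hT.measurableSet i
    fun x => ?_
  have hTx := isCompact_coordSection hT i x
  -- It suffices that the section of the symmetrised sum lies in the centred disc with the area of
  -- the original section.
  rw [← volume_closedBall_discRadius hTx.measure_lt_top.ne]
  refine measure_mono fun z hz => ?_
  obtain ⟨g, hg, hsum⟩ := (Set.mem_fintype_sum _ _).1 hz
  choose b hb hbg using hg
  obtain rfl : (fun l => c l * b l) = g := funext hbg
  have hb' := fun l => (mem_schwarz_iff hB).1 (hb l)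
  -- Varying only the `i`-th coordinate of each `b l` leaves the other coordinates of the sum equal
  -- to those of `x`.
  have hsub : ∑ l, (fun z => c l i * z) '' coordSection B i (b l) ⊆
      coordSection (∑ l, (fun x => c l * x) '' B) i x := by
    intro w hw
    obtain ⟨g, hg, rfl⟩ := (Set.mem_fintype_sum _ _).1 hw
    choose v hv hvg using hg
    obtain rfl : (fun l => c l i * v l) = g := funext hvg
    refine (Set.mem_fintype_sum _ _).2
      ⟨fun l => c l * Function.update (b l) i (v l), fun l => ⟨_, hv l, rfl⟩, ?_⟩
    ext j
    by_cases hj : j = i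
    · subst hj
      simp [Finset.sum_apply]
    · have := congrFun hsum j
      simpa [Finset.sum_apply, hj] using this
  have hzi : z = ∑ l, c l i * b l i := by
    have := congrFun hsum i
    simpa [Finset.sum_apply] using this.symm
  rw [mem_closedBall_zero_iff]
  calc ‖z‖ ≤ ∑ l, ‖c l i‖ * ‖b l i‖ := by
        rw [hzi]
        exact (norm_sum_le _ _).trans (by simp)
    _ ≤ ∑ l, ‖c l i‖ * discRadius (coordSection B i (b l)) := by
        gcongr with l
        exact (hb' l).2
    _ = (∑ l, ‖c l i‖ * √(volume.real (coordSection B i (b l)))) / √Real.pi := by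
        simp_rw [discRadius, Real.sqrt_div measureReal_nonneg, Finset.sum_div, mul_div_assoc]
    _ ≤ √(volume.real (∑ l, (fun z => c l i * z) '' coordSection B i (b l))) / √Real.pi := by
        gcongr
        exact sum_norm_mul_sqrt_volume_le _ (fun l => isCompact_coordSection hB i _) fun l => (hb' l).1
    _ = discRadius (∑ l, (fun z => c l i * z) '' coordSection B i (b l)) := by
        rw [discRadius, Real.sqrt_div measureReal_nonneg]
    _ ≤ _ := discRadius_mono hsub hTx.measure_lt_top.ne

end Volume

/-- `B` is invariant under multiplying the coordinates in `s` by complex numbers of modulus one. -/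
def PhaseInvariant (s : Finset ι) (B : Set (ι → ℂ)) : Prop :=
  ∀ u : ι → ℂ, (∀ i, ‖u i‖ = 1) → (∀ i ∉ s, u i = 1) → ∀ x ∈ B, u * x ∈ B

/-- A phase in coordinate `i` changes neither the section nor `‖x i‖`; phases in the coordinates of
`s` preserve the section by the invariance of `B`. -/
theorem PhaseInvariant.schwarz {s : Finset ι} {B : Set (ι → ℂ)} (h : PhaseInvariant s B) (i : ι) :
    PhaseInvariant (insert i s) (schwarz B i) := by
  have hsub : ∀ u : ι → ℂ, (∀ j, ‖u j‖ = 1) → (∀ j ∉ insert i s, u j = 1) → ∀ x,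
      coordSection B i x ⊆ coordSection B i (u * x) := by
    intro u hu hus x z hz
    have hmem := h (Function.update u i 1) (fun j => ?_) (fun j hj => ?_) _ hz
    · have : Function.update u i 1 * Function.update x i z = Function.update (u * x) i z := by
        ext j
        by_cases hj : j = i
        · subst hj; simp
        · simp [hj]
      rwa [this] at hmem
    · by_cases hj : j = i
      · subst hj; simp
      · simp [hj, hu]
    · by_cases hji : j = i
      · subst hji; simp
      · simpa [hji] using hus j (by simp [hji, hj])
  intro u hu hus x hx
  have heq : coordSection B i (u * x) = coordSection B i x := by
    refine (hsub u⁻¹ (by simp [hu]) (fun j hj => by simp [hus j hj]) (u * x)).trans ?_ |>.antisymm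
      (hsub u hu hus x)
    rw [← mul_assoc, show u⁻¹ * u = 1 from funext fun j => inv_mul_cancel₀
      (norm_ne_zero_iff.1 (by simp [hu])), one_mul]
  refine ⟨heq ▸ hx.1, ?_⟩
  rw [heq, Pi.mul_apply, norm_mul, hu, one_mul]
  exact hx.2

section Main

variable [Fintype ι] {κ : Type*} [Fintype κ]

/-- Phases `u l` with `c l * u l = ‖c l‖` keep `x` in `B`, so the sum contains the image of `B`
under multiplication by `∑ l, ‖c l i‖` in each coordinate `i`. -/
theorem PhaseInvariant.volume_le (c : κ → ι → ℂ) {B : Set (ι → ℂ)}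
    (h : PhaseInvariant Finset.univ B) :
    ENNReal.ofReal ((∏ i, ∑ l, ‖c l i‖) ^ 2) * volume B ≤
      volume (∑ l, (fun x => c l * x) '' B) := by
  have hdet := addHaar_image_complex_linearMap volume
    (Matrix.toLin' (Matrix.diagonal fun i => ((∑ l, ‖c l i‖ : ℝ) : ℂ))) B
  rw [LinearMap.det_toLin', Matrix.det_diagonal, ← Complex.ofReal_prod, Complex.norm_real,
    Real.norm_eq_abs, sq_abs] at hdet
  rw [← hdet]
  refine measure_mono ?_
  rintro _ ⟨x, hx, rfl⟩
  have hphase : ∀ z : ℂ, ∃ u : ℂ, ‖u‖ = 1 ∧ z * u = ‖z‖ := by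
    intro z
    by_cases hz : z = 0
    · exact ⟨1, by simp [hz]⟩
    · refine ⟨‖z‖ / z, by simp [hz], by field_simp⟩
  choose u hu hcu using fun l i => hphase (c l i)
  refine (Set.mem_fintype_sum _ _).2
    ⟨fun l => c l * (u l * x), fun l => ⟨_, h (u l) (hu l) (by simp) x hx, rfl⟩, ?_⟩
  ext i
  simp [Finset.sum_apply, ← mul_assoc, hcu, Matrix.mulVec_diagonal, Finset.sum_mul]

/-- The volume inequality for diagonal complex matrices. -/
theorem IsCompact.volume_sum_image_mul_ge (c : κ → ι → ℂ) {B : Set (ι → ℂ)} (hB : IsCompact B) :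
    ENNReal.ofReal ((∏ i, ∑ l, ‖c l i‖) ^ 2) * volume B ≤
      volume (∑ l, (fun x => c l * x) '' B) := by
  have key : ∀ s : Finset ι, ∃ C : Set (ι → ℂ), IsCompact C ∧ volume C = volume B ∧
      PhaseInvariant s C ∧
      volume (∑ l, (fun x => c l * x) '' C) ≤ volume (∑ l, (fun x => c l * x) '' B) := by
    intro s
    induction s using Finset.induction_on with
    | empty =>
      refine ⟨B, hB, rfl, fun u _ hu x hx => ?_, le_rfl⟩
      rwa [show u = 1 from funext fun i => hu i (by simp), one_mul]
    | insert i s _ ih =>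
      obtain ⟨C, hC, hvol, hinv, hle⟩ := ih
      exact ⟨schwarz C i, isCompact_schwarz hC i, (volume_schwarz hC i).trans hvol,
        hinv.schwarz i, (volume_sum_image_schwarz_le c hC i).trans hle⟩
  obtain ⟨C, -, hvol, hinv, hle⟩ := key Finset.univ
  exact hvol ▸ (hinv.volume_le c).trans hle

end Main

end Symmetrisation

/-! ### Passing from real to complex coordinates -/

section Complexification

variable {d k : ℕ}

/-- The set `A + iA` of complex vectors whose real and imaginary parts lie in `A`. -/
def complexify (A : Set (Fin d → ℝ)) : Set (Fin d → ℂ) :=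
  {z | (fun i => (z i).re) ∈ A ∧ (fun i => (z i).im) ∈ A}

theorem IsCompact.complexify {A : Set (Fin d → ℝ)} (hA : IsCompact A) :
    IsCompact (complexify A) := by
  have h := (hA.prod hA).image (f := fun p : (Fin d → ℝ) × (Fin d → ℝ) =>
    fun i => (p.1 i : ℂ) + p.2 i * Complex.I) (by fun_prop)
  refine h.of_isClosed_subset ?_ ?_
  · exact (hA.isClosed.preimage (by fun_prop)).inter (hA.isClosed.preimage (by fun_prop))
  · rintro z ⟨h1, h2⟩
    exact ⟨(_, _), ⟨h1, h2⟩, funext fun i => Complex.re_add_im (z i)⟩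

theorem volume_complexify (A : Set (Fin d → ℝ)) : volume (complexify A) = volume A ^ 2 := by
  have h1 := volume_preserving_pi
    (fun _ : Fin d => Complex.volume_preserving_equiv_real_prod)
  have h2 := volume_measurePreserving_arrowProdEquivProdArrow ℝ ℝ (Fin d)
  have e : complexify A = (MeasurableEquiv.piCongrRight
      fun _ : Fin d => Complex.measurableEquivRealProd) ⁻¹'
        (MeasurableEquiv.arrowProdEquivProdArrow ℝ ℝ (Fin d) ⁻¹' (A ×ˢ A)) := rfl
  rw [e, MeasurePreserving.measure_preimage_equiv h1, h2.measure_preimage_equiv,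
    Measure.volume_eq_prod, Measure.prod_prod, sq]

theorem map_ofReal_mulVec_re (M : Matrix (Fin d) (Fin d) ℝ) (z : Fin d → ℂ) (i : Fin d) :
    ((M.map Complex.ofReal).mulVec z i).re = M.mulVec (fun j => (z j).re) i := by
  simp [Matrix.mulVec, dotProduct]

theorem map_ofReal_mulVec_im (M : Matrix (Fin d) (Fin d) ℝ) (z : Fin d → ℂ) (i : Fin d) :
    ((M.map Complex.ofReal).mulVec z i).im = M.mulVec (fun j => (z j).im) i := by
  simp [Matrix.mulVec, dotProduct]

theorem sum_image_complexify_subset (L : Fin k → Matrix (Fin d) (Fin d) ℝ)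
    (A : Set (Fin d → ℝ)) :
    ∑ l, ((L l).map Complex.ofReal).mulVec '' complexify A ⊆ complexify (sumOfImages L A) := by
  intro z hz
  obtain ⟨g, hg, rfl⟩ := (Set.mem_fintype_sum _ _).1 hz
  choose b hb hbg using hg
  obtain rfl : (fun l => ((L l).map Complex.ofReal).mulVec (b l)) = g := funext hbg
  constructor
  · refine (Set.mem_fintype_sum _ _).2
      ⟨fun l => (L l).mulVec fun j => (b l j).re, fun l => ⟨_, (hb l).1, rfl⟩, ?_⟩
    ext i
    simp [Finset.sum_apply, map_ofReal_mulVec_re]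
  · refine (Set.mem_fintype_sum _ _).2
      ⟨fun l => (L l).mulVec fun j => (b l j).im, fun l => ⟨_, (hb l).2, rfl⟩, ?_⟩
    ext i
    simp [Finset.sum_apply, map_ofReal_mulVec_im]

theorem SimultaneouslyDiagonalisableInto.volume_le {L : Fin k → Matrix (Fin d) (Fin d) ℝ}
    {ev : Fin k → Fin d → ℂ} (hL : SimultaneouslyDiagonalisableInto L ev)
    {A : Set (Fin d → ℝ)} (hA : IsCompact A) :
    ENNReal.ofReal (∏ i, ∑ l, ‖ev l i‖) * volume A ≤ volume (sumOfImages L A) := by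
  obtain ⟨P, hP, hD⟩ := hL
  have hPdet : IsUnit P.det := (Matrix.isUnit_iff_isUnit_det P).1 hP
  set Q : (Fin d → ℂ) →ₗ[ℂ] (Fin d → ℂ) := Matrix.toLin' P⁻¹ with hQ
  have hQdet : LinearMap.det Q ≠ 0 := by
    rw [hQ, LinearMap.det_toLin']
    exact ((Matrix.isUnit_nonsing_inv_det_iff).2 hPdet).ne_zero
  have hcomm : ∀ l (x : Fin d → ℂ), ev l * Q x = Q (((L l).map Complex.ofReal).mulVec x) := by
    intro l x
    have h : Matrix.diagonal (ev l) * P⁻¹ = P⁻¹ * (L l).map Complex.ofReal := by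
      rw [← hD l, Matrix.mul_assoc, Matrix.mul_nonsing_inv P hPdet, Matrix.mul_one]
    rw [hQ, Matrix.toLin'_apply, Matrix.toLin'_apply, Matrix.mulVec_mulVec, ← h,
      ← Matrix.mulVec_mulVec]
    ext i
    rw [Matrix.mulVec_diagonal, Pi.mul_apply]
  have hsum : ∑ l, (fun x => ev l * x) '' (Q '' complexify A) =
      Q '' ∑ l, ((L l).map Complex.ofReal).mulVec '' complexify A := by
    rw [Set.image_finsetSum]
    refine Finset.sum_congr rfl fun l _ => ?_
    rw [Set.image_image, Set.image_image]
    simp_rw [hcomm]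
  have key := (hA.complexify.image Q.continuous_of_finiteDimensional).volume_sum_image_mul_ge ev
  rw [hsum, addHaar_image_complex_linearMap, addHaar_image_complex_linearMap,
    mul_left_comm] at key
  -- The common factor `‖det Q‖²` cancels, leaving the square of the desired inequality.
  have key' := (ENNReal.mul_le_mul_iff_right (by simpa using hQdet) ENNReal.ofReal_ne_top).1 key
  have key'' := key'.trans (measure_mono (sum_image_complexify_subset L A))
  rw [volume_complexify, volume_complexify, ENNReal.ofReal_pow (by positivity),
    ← mul_pow] at key''
  exact (ENNReal.pow_le_pow_left_iff two_ne_zero).1 key''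

end Complexification

/-! ### Sets attaining equality -/

section Equality

variable {d k : ℕ}

/-- A diagonal matrix whose entries agree at indices with conjugate joint eigenvalues is real in
the original coordinates. -/
theorem exists_real_matrix_of_conj_compatible {L : Fin k → Matrix (Fin d) (Fin d) ℝ}
    {ev : Fin k → Fin d → ℂ} {P : Matrix (Fin d) (Fin d) ℂ} (hP : IsUnit P.det)
    (hD : ∀ l, P⁻¹ * (L l).map Complex.ofReal * P = Matrix.diagonal (ev l)) (w : Fin d → ℝ)
    (hw : ∀ i j, (∀ l, ev l i = starRingEnd ℂ (ev l j)) → w i = w j) :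
    ∃ R : Matrix (Fin d) (Fin d) ℝ,
      R.map Complex.ofReal = P * Matrix.diagonal (fun i => (w i : ℂ)) * P⁻¹ := by
  set Z := P * Matrix.diagonal (fun i => (w i : ℂ)) * P⁻¹ with hZ
  set Δ := Matrix.diagonal (fun i => (w i : ℂ)) with hΔ
  let σ : Matrix (Fin d) (Fin d) ℂ →+* Matrix (Fin d) (Fin d) ℂ := (starRingEnd ℂ).mapMatrix
  have hPP : P * P⁻¹ = 1 := Matrix.mul_nonsing_inv P hP
  have hσL : ∀ l, σ ((L l).map Complex.ofReal) = (L l).map Complex.ofReal := by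
    intro l; ext i j; simp [σ]
  have hσΔ : σ Δ = Δ := by
    ext i j
    by_cases hij : i = j <;> simp [σ, hΔ, hij]
  have hLP : ∀ l, (L l).map Complex.ofReal * P = P * Matrix.diagonal (ev l) := by
    intro l
    rw [← hD l, ← Matrix.mul_assoc, ← Matrix.mul_assoc, hPP, Matrix.one_mul]
  -- Conjugating `L P = P D` shows that `σ P` diagonalises the same matrices into the conjugate
  -- diagonals, so `P⁻¹ * σ P` intertwines the two.
  have hM : ∀ l, Matrix.diagonal (ev l) * (P⁻¹ * σ P) =
      (P⁻¹ * σ P) * σ (Matrix.diagonal (ev l)) := by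
    intro l
    have h := congrArg σ (hLP l)
    rw [map_mul, map_mul, hσL] at h
    rw [Matrix.mul_assoc, ← h, ← hD l]
    simp only [Matrix.mul_assoc]
    rw [← Matrix.mul_assoc P, hPP, Matrix.one_mul]
  -- A nonzero `(i, j)` entry forces `ev l i` to be the conjugate of `ev l j` for all `l`, and then
  -- `w i = w j`.
  have hΔM : Δ * (P⁻¹ * σ P) = (P⁻¹ * σ P) * Δ := by
    ext i j
    rw [hΔ, Matrix.diagonal_mul, Matrix.mul_diagonal]
    by_cases h0 : (P⁻¹ * σ P) i j = 0
    · simp [h0]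
    · rw [hw i j fun l => ?_, mul_comm]
      have h := congrFun (congrFun (hM l) i) j
      have hσev : σ (Matrix.diagonal (ev l)) =
          Matrix.diagonal fun j => starRingEnd ℂ (ev l j) := by
        ext a b
        by_cases hab : a = b <;> simp [σ, hab]
      rw [hσev, Matrix.diagonal_mul, Matrix.mul_diagonal, mul_comm] at h
      exact mul_left_cancel₀ h0 h
  have hσP : σ P * σ P⁻¹ = 1 := by rw [← map_mul, hPP, map_one]
  have hfix : σ Z = Z := by
    have h1 : Z * σ P = σ P * Δ := by
      rw [hZ, Matrix.mul_assoc, Matrix.mul_assoc, hΔM, ← Matrix.mul_assoc, ← Matrix.mul_assoc,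
        hPP, Matrix.one_mul]
    have h2 : σ Z = σ P * Δ * σ P⁻¹ := by rw [hZ, map_mul, map_mul, hσΔ]
    rw [h2, ← h1, Matrix.mul_assoc, hσP, Matrix.mul_one]
  refine ⟨Z.map Complex.re, ?_⟩
  ext i j
  exact Complex.conj_eq_iff_re.1 (congrFun (congrFun hfix i) j)

/-- The vectors whose coordinates with respect to the eigenbasis `P` have modulus at most one. -/
def eigenPolydisc (P : Matrix (Fin d) (Fin d) ℂ) : Set (Fin d → ℝ) :=
  {x | ∀ i, ‖P⁻¹.mulVec (fun j => (x j : ℂ)) i‖ ≤ 1}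

theorem isCompact_eigenPolydisc {P : Matrix (Fin d) (Fin d) ℂ} (hP : IsUnit P.det) :
    IsCompact (eigenPolydisc P) := by
  have hK : IsCompact (Set.univ.pi fun _ : Fin d => Metric.closedBall (0 : ℂ) 1) :=
    isCompact_univ_pi fun _ => isCompact_closedBall _ _
  have hcont : Continuous fun z : Fin d → ℂ => fun i => (P.mulVec z i).re := by fun_prop
  refine (hK.image hcont).of_isClosed_subset ?_ fun x hx => ?_
  · simp_rw [eigenPolydisc, Set.ofPred_forall]
    exact isClosed_iInter fun i => isClosed_le (by fun_prop) continuous_const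
  · refine ⟨P⁻¹.mulVec fun j => (x j : ℂ), fun i _ => by simpa using hx i, ?_⟩
    ext i
    simp [Matrix.mulVec_mulVec, Matrix.mul_nonsing_inv P hP]

theorem volume_eigenPolydisc_pos (P : Matrix (Fin d) (Fin d) ℂ) :
    0 < volume (eigenPolydisc P) := by
  have hopen : IsOpen {x : Fin d → ℝ | ∀ i, ‖P⁻¹.mulVec (fun j => (x j : ℂ)) i‖ < 1} := by
    simp_rw [Set.ofPred_forall]
    exact isOpen_iInter_of_finite fun i => isOpen_lt (by fun_prop) continuous_const
  have hzero : (fun j => (((0 : Fin d → ℝ) j : ℝ) : ℂ)) = 0 := by ext; simp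
  refine (hopen.measure_pos volume ⟨0, fun i => ?_⟩).trans_le
    (measure_mono fun x hx i => (hx i).le)
  rw [hzero, Matrix.mulVec_zero]
  simp

theorem ofReal_mulVec {M : Matrix (Fin d) (Fin d) ℝ} (x : Fin d → ℝ) :
    (fun j => ((M.mulVec x j : ℝ) : ℂ)) = (M.map Complex.ofReal).mulVec fun j => (x j : ℂ) := by
  ext i
  simp [Matrix.mulVec, dotProduct]

theorem volume_sumOfImages_eigenPolydisc_le {L : Fin k → Matrix (Fin d) (Fin d) ℝ}
    {ev : Fin k → Fin d → ℂ} {P : Matrix (Fin d) (Fin d) ℂ} (hP : IsUnit P.det)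
    (hD : ∀ l, P⁻¹ * (L l).map Complex.ofReal * P = Matrix.diagonal (ev l)) :
    volume (sumOfImages L (eigenPolydisc P)) ≤
      ENNReal.ofReal (∏ i, ∑ l, ‖ev l i‖) * volume (eigenPolydisc P) := by
  set s : Fin d → ℝ := fun i => ∑ l, ‖ev l i‖ with hs
  have hs0 : ∀ i, 0 ≤ s i := fun i => by positivity
  have hconj : ∀ i j, (∀ l, ev l i = starRingEnd ℂ (ev l j)) → s i = s j := by
    intro i j h
    simp [hs, h]
  have hPP : P * P⁻¹ = 1 := Matrix.mul_nonsing_inv P hP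
  have hPP' : P⁻¹ * P = 1 := Matrix.nonsing_inv_mul P hP
  obtain ⟨R, hR⟩ := exists_real_matrix_of_conj_compatible hP hD s hconj
  -- `R'` inverts `R` where `s i ≠ 0`. Where `s i = 0` its entry is `0`, which is harmless: the
  -- bound below makes that coordinate of `y` vanish.
  obtain ⟨R', hR'⟩ := exists_real_matrix_of_conj_compatible hP hD (fun i => (s i)⁻¹)
    fun i j h => by rw [hconj i j h]
  have hcoord : ∀ {M : Matrix (Fin d) (Fin d) ℝ} {w : Fin d → ℂ},
      M.map Complex.ofReal = P * Matrix.diagonal w * P⁻¹ → ∀ x : Fin d → ℝ, ∀ i,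
      P⁻¹.mulVec (fun j => ((M.mulVec x j : ℝ) : ℂ)) i =
        w i * P⁻¹.mulVec (fun j => (x j : ℂ)) i := by
    intro M w h x i
    rw [ofReal_mulVec, h, Matrix.mulVec_mulVec, ← Matrix.mul_assoc, ← Matrix.mul_assoc, hPP',
      Matrix.one_mul, ← Matrix.mulVec_mulVec, Matrix.mulVec_diagonal]
  have hLw : ∀ l, (L l).map Complex.ofReal = P * Matrix.diagonal (ev l) * P⁻¹ := by
    intro l
    rw [← hD l]
    simp only [Matrix.mul_assoc]
    rw [hPP, Matrix.mul_one, ← Matrix.mul_assoc, hPP, Matrix.one_mul]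
  have hdet : R.det = ∏ i, s i := by
    have h := congrArg Matrix.det hR
    rw [Matrix.det_mul_right_comm, hPP, Matrix.one_mul, Matrix.det_diagonal] at h
    have h' : ((R.det : ℝ) : ℂ) = (R.map Complex.ofReal).det := Complex.ofRealHom.map_det R
    exact_mod_cast h'.trans h
  -- By the triangle inequality the `i`-th eigencoordinate of the sum is at most `s i`, so `R'`
  -- brings it back into the polydisc.
  have hsub : sumOfImages L (eigenPolydisc P) ⊆ Matrix.toLin' R '' eigenPolydisc P := by
    intro y hy
    obtain ⟨g, hg, rfl⟩ := (Set.mem_fintype_sum _ _).1 hy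
    choose a ha hag using hg
    obtain rfl : (fun l => (L l).mulVec (a l)) = g := funext hag
    set y := ∑ l, (L l).mulVec (a l) with hy
    have hbound : ∀ i, ‖P⁻¹.mulVec (fun j => (y j : ℂ)) i‖ ≤ s i := by
      intro i
      have h : (fun j => (y j : ℂ)) = ∑ l, fun j => (((L l).mulVec (a l) j : ℝ) : ℂ) := by
        ext j
        simp [hy, Finset.sum_apply]
      rw [h, Matrix.mulVec_sum, Finset.sum_apply]
      refine (norm_sum_le _ _).trans (Finset.sum_le_sum fun l _ => ?_)
      rw [hcoord (hLw l), norm_mul]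
      exact mul_le_of_le_one_right (norm_nonneg _) (ha l i)
    refine ⟨R'.mulVec y, fun i => ?_, ?_⟩
    · rw [hcoord hR', norm_mul, Complex.norm_real, Real.norm_of_nonneg (inv_nonneg.2 (hs0 i))]
      calc (s i)⁻¹ * _ ≤ (s i)⁻¹ * s i := by
            gcongr
            exact hbound i
        _ ≤ 1 := inv_mul_le_one
    · have hinj : P⁻¹.mulVec (fun j => ((R.mulVec (R'.mulVec y) j : ℝ) : ℂ)) =
          P⁻¹.mulVec fun j => (y j : ℂ) := by
        ext i
        rw [hcoord hR, hcoord hR', ← mul_assoc]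
        by_cases h0 : s i = 0
        · have := hbound i
          rw [h0] at this
          rw [norm_le_zero_iff.1 this, mul_zero]
        · rw [← Complex.ofReal_mul, mul_inv_cancel₀ h0, Complex.ofReal_one, one_mul]
      have hinj' := congrArg P.mulVec hinj
      rw [Matrix.mulVec_mulVec _ P, Matrix.mulVec_mulVec _ P, hPP, Matrix.one_mulVec,
        Matrix.one_mulVec] at hinj'
      rw [Matrix.toLin'_apply]
      ext i
      exact_mod_cast congrFun hinj' i
  calc volume (sumOfImages L (eigenPolydisc P))
      ≤ volume (Matrix.toLin' R '' eigenPolydisc P) := measure_mono hsub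
    _ = _ := by
      rw [Measure.addHaar_image_linearMap, LinearMap.det_toLin', hdet,
        abs_of_nonneg (Finset.prod_nonneg fun i _ => hs0 i)]

end Equality

theorem theorem3p1 {k d : ℕ} (L : Fin k → Matrix (Fin d) (Fin d) ℝ) (ev : Fin k → Fin d → ℂ)
    (hL : SimultaneouslyDiagonalisableInto L ev) :
    (∀ A : Set (Fin d → ℝ), IsCompact A →
      ENNReal.ofReal (∏ i, ∑ l, ‖ev l i‖) * volume A ≤ volume (sumOfImages L A)) ∧
    ∃ A : Set (Fin d → ℝ), IsCompact A ∧ 0 < volume A ∧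
      volume (sumOfImages L A) = ENNReal.ofReal (∏ i, ∑ l, ‖ev l i‖) * volume A := by
  refine ⟨fun A hA => hL.volume_le hA, ?_⟩
  have hL' := hL
  obtain ⟨P, hP, hD⟩ := hL'
  have hPdet : IsUnit P.det := (Matrix.isUnit_iff_isUnit_det P).1 hP
  have hA := isCompact_eigenPolydisc hPdet
  exact ⟨eigenPolydisc P, hA, volume_eigenPolydisc_pos P,
    le_antisymm (volume_sumOfImages_eigenPolydisc_le hPdet hD) (hL.volume_le hA)⟩
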